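/- Let $(c_n)_{n\ge 1}$ be an unbounded increasing sequence of real numbers with $c_n>1$ for all $n$. Let $d_n\in M_n=M_n(\mathbb C)$ be the diagonal matrix whose $k$th diagonal entry is $c_n^k$ ($1\le k\le n$). Let $M=\oplus^\infty_n (M_n\oplus M_n)$ be the von Neumann algebra of bounded sequences, and let $N$ be its subalgebra consisting of all tuples $((x_n, d_nx_nd_n^{-1}))_n$ in $M$; such a tuple is also written $(x_n)$, and $p$ denotes the norm of $N$. Let $L_n$ be the left shift on $\mathbb C^n$ ($L_ne_1=0$, $L_ne_{j+1}=e_j$). For $k\le n$ put $E_{n,k}=\{i\in\mathbb Z : \frac nk\le i\le\frac{2n}{k}\}$ and $u_{n,k}=\frac1{|E_{n,k}|}\sum_{i\in E_{n,k}}L_n^i$; for $k>n$ put $u_{n,k}=I_n$. Let $u_k=(u_{n,k})_n\in N$ for $k \geq 1$, and define the (in general non-unital) algebra $$A=\{a\in N:\ p(au_k-a)+p(u_ka-a)\to 0 \text{ as } k\to\infty\}.$$ A left (right) ideal $J$ of $A$ is a linear subspace with $AJ\subseteq J$ ($JA\subseteq J$); it is modular if there is $u\in A$ with $a-au\in J$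 (resp. $a-ua\in J$) for all $a\in A$. A maximal modular left (right) ideal is a maximal element among the proper modular left (right) ideals. A minimal idempotent of a complex algebra $B$ is an idempotent $e\ne0$ with $eBe=\mathbb Ce$. The canonical copy of $x\in M_n$ in $A$ is the tuple with $n$th entry $(x,d_nxd_n^{-1})$ and all other entries $0$. Then the maximal modular right (resp. left) ideals of $A$ are exactly the sets $$(1-e)A=\{a-ea: a\in A\}\qquad(\text{resp. } A(1-e)=\{a-ae : a\in A\}),$$ where $e$ is a minimal idempotent of $A$ which is the canonical copy in $A$ of a minimal idempotent of $M_n$ for some $n\ge 1$. Moreover, the socle of $A$ is the set $A_{00}$ of all finitely supported tuples in $N$: both the sum of all minimal left ideals of $A$ and the sum of all minimal right ideals of $A$ are equal to $A_{00}$. -/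

import Mathlib

open Filter Topology
open scoped ENNReal Matrix.Norms.L2Operator

noncomputable section

/-! ### Ideals and idempotents in a (possibly non-unital) complex algebra -/

section General

variable {A : Type*} [NonUnitalRing A] [Module ℂ A]

/-- A left ideal of the algebra `A`: a linear subspace `J` with `A J ⊆ J`. -/
def IsLeftIdeal (J : Submodule ℂ A) : Prop := ∀ a : A, ∀ x ∈ J, a * x ∈ J

/-- A right ideal of the algebra `A`: a linear subspace `J` with `J A ⊆ J`. -/
def IsRightIdeal (J : Submodule ℂ A) : Prop := ∀ a : A, ∀ x ∈ J, x * a ∈ J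

/-- A left ideal `J` is modular if there is `u` with `A (1 - u) ⊆ J`. -/
def IsModularLeftIdeal (J : Submodule ℂ A) : Prop :=
  IsLeftIdeal J ∧ ∃ u : A, ∀ a : A, a - a * u ∈ J

/-- A right ideal `J` is modular if there is `u` with `(1 - u) A ⊆ J`. -/
def IsModularRightIdeal (J : Submodule ℂ A) : Prop :=
  IsRightIdeal J ∧ ∃ u : A, ∀ a : A, a - u * a ∈ J

/-- Maximal modular left ideals: maximal elements among the proper modular left ideals. -/
def IsMaximalModularLeftIdeal (J : Submodule ℂ A) : Prop :=
  Maximal (fun K : Submodule ℂ A => IsModularLeftIdeal K ∧ K ≠ ⊤) J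

/-- Maximal modular right ideals: maximal elements among the proper modular right ideals. -/
def IsMaximalModularRightIdeal (J : Submodule ℂ A) : Prop :=
  Maximal (fun K : Submodule ℂ A => IsModularRightIdeal K ∧ K ≠ ⊤) J

/-- Minimal left ideals: minimal elements among the nonzero left ideals. -/
def IsMinimalLeftIdeal (J : Submodule ℂ A) : Prop :=
  Minimal (fun K : Submodule ℂ A => IsLeftIdeal K ∧ K ≠ ⊥) J

/-- Minimal right ideals: minimal elements among the nonzero right ideals. -/
def IsMinimalRightIdeal (J : Submodule ℂ A) : Prop :=
  Minimal (fun K : Submodule ℂ A => IsRightIdeal K ∧ K ≠ ⊥) J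

variable (A) in
/-- The left socle: the sum of all minimal left ideals. -/
def leftSocle : Submodule ℂ A := sSup {J | IsMinimalLeftIdeal J}

variable (A) in
/-- The right socle: the sum of all minimal right ideals. -/
def rightSocle : Submodule ℂ A := sSup {J | IsMinimalRightIdeal J}

/-- A minimal idempotent: a nonzero idempotent `e` with `e A e = ℂ e`. -/
def IsMinimalIdempotent (e : A) : Prop :=
  e ≠ 0 ∧ e * e = e ∧ Set.range (fun a : A => e * a * e) = Set.range (fun z : ℂ => z • e)

end General

/-! ### The example -/

/-- The C*-algebra `M_n` of complex `n × n` matrices, with the operator norm. -/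
abbrev Mat (n : ℕ+) : Type := Matrix (Fin n) (Fin n) ℂ

/-- The von Neumann algebra `M = ⊕^∞_n (M_n ⊕ M_n)` of bounded sequences, with the supremum norm. -/
abbrev BigM : Type := lp (fun n : ℕ+ => Mat n × Mat n) ∞

instance : NonUnitalNormedRing BigM := lp.nonUnitalNormedRing

instance : NonUnitalRing BigM := lp.nonUnitalRing

instance : Module ℂ BigM := inferInstance

/-- The diagonal matrix `d_n`, whose `k`-th diagonal entry (`k = 1, …, n`) is `c_n ^ k`. -/
def dMat (c : ℕ+ → ℝ) (n : ℕ+) : Mat n :=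
  Matrix.diagonal fun i => ((c n : ℂ) ^ ((i : ℕ) + 1))

/-- The pair `(x, d_n x d_n⁻¹)`. -/
def twist (c : ℕ+ → ℝ) (n : ℕ+) (x : Mat n) : Mat n × Mat n :=
  (x, dMat c n * x * (dMat c n)⁻¹)

/-- The left shift `L_n` on `ℂ^n`: `L_n e_1 = 0` and `L_n e_{j+1} = e_j`. -/
def shiftMat (n : ℕ+) : Mat n :=
  Matrix.of fun i j => if (j : ℕ) = (i : ℕ) + 1 then 1 else 0

/-- The integers in the interval `[n / k, 2 n / k]`. -/
def intInterval (n k : ℕ+) : Finset ℕ :=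
  Finset.Icc ⌈(n : ℚ) / (k : ℚ)⌉₊ ⌊2 * (n : ℚ) / (k : ℚ)⌋₊

/-- `u_{n,k}`: the average of the powers `L_n ^ i` over the integers `i` in `[n / k, 2 n / k]` if
`n ≥ k`, and the identity matrix if `n < k`. -/
def uMat (n k : ℕ+) : Mat n :=
  if k ≤ n then ((intInterval n k).card : ℂ)⁻¹ • ∑ i ∈ intInterval n k, shiftMat n ^ i else 1

section Helpers

variable {c : ℕ+ → ℝ}

theorem isUnit_det_dMat (hc : ∀ n, 1 < c n) (n : ℕ+) : IsUnit (dMat c n).det := by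
  rw [dMat, Matrix.det_diagonal, isUnit_iff_ne_zero, Finset.prod_ne_zero_iff]
  intro i _
  have : (c n : ℂ) ≠ 0 := by
    have := hc n
    exact_mod_cast (by linarith : c n ≠ 0)
  exact pow_ne_zero _ this

theorem twist_mul (hc : ∀ n, 1 < c n) (n : ℕ+) (x y : Mat n) :
    twist c n (x * y) = twist c n x * twist c n y := by
  have h := Matrix.nonsing_inv_mul (dMat c n) (isUnit_det_dMat hc n)
  simp only [twist, Prod.mk_mul_mk, Prod.mk.injEq, true_and]
  calc dMat c n * (x * y) * (dMat c n)⁻¹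
      = dMat c n * x * 1 * (y * (dMat c n)⁻¹) := by simp only [mul_one, mul_assoc]
    _ = _ := by rw [← h]; simp only [mul_assoc]

theorem twist_one (hc : ∀ n, 1 < c n) (n : ℕ+) : twist c n 1 = 1 := by
  simp [twist, Matrix.mul_nonsing_inv (dMat c n) (isUnit_det_dMat hc n), Prod.ext_iff]

theorem twist_add (n : ℕ+) (x y : Mat n) : twist c n (x + y) = twist c n x + twist c n y := by
  simp [twist, mul_add, add_mul]

theorem twist_zero (n : ℕ+) : twist c n 0 = 0 := by
  simp [twist]

theorem twist_smul (n : ℕ+) (z : ℂ) (x : Mat n) : twist c n (z • x) = z • twist c n x := by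
  simp [twist]

theorem twist_sum (n : ℕ+) (s : Finset ℕ) (f : ℕ → Mat n) :
    twist c n (∑ i ∈ s, f i) = ∑ i ∈ s, twist c n (f i) :=
  map_sum (⟨⟨twist c n, twist_zero n⟩, twist_add n⟩ : Mat n →+ Mat n × Mat n) f s

theorem twist_pow (hc : ∀ n, 1 < c n) (n : ℕ+) (x : Mat n) (i : ℕ) :
    twist c n (x ^ i) = twist c n x ^ i := by
  induction i with
  | zero => simp [twist_one hc]
  | succ i ih => rw [pow_succ, pow_succ, twist_mul hc, ih]

theorem norm_shiftMat_le (n : ℕ+) : ‖shiftMat n‖ ≤ 1 := by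
  have h : (shiftMat n).conjTranspose * shiftMat n =
      Matrix.diagonal fun j : Fin n => if (j : ℕ) = 0 then (0 : ℂ) else 1 := by
    ext i j
    rw [Matrix.mul_apply, Matrix.diagonal_apply]
    simp only [Matrix.conjTranspose_apply, shiftMat, Matrix.of_apply]
    by_cases hj : (j : ℕ) = 0
    · by_cases hij : i = j
      · subst hij; simp [hj]
      · simp [hj, hij]
    · have hjn := j.isLt
      rw [Finset.sum_eq_single (⟨(j : ℕ) - 1, by omega⟩ : Fin n)]
      · have h1 : (j : ℕ) = (j : ℕ) - 1 + 1 := by omega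
        by_cases hij : i = j
        · subst hij
          simp only [← h1]
          simp [hj]
        · have h2 : ¬ (i : ℕ) = (j : ℕ) - 1 + 1 := by
            intro h; exact hij (Fin.ext (by omega))
          simp [hij, h2]
      · intro b _ hb
        have : ¬ (j : ℕ) = (b : ℕ) + 1 := by
          intro h; exact hb (Fin.ext (by simp [h]))
        simp [this]
      · simp
  have h2 : ‖shiftMat n‖ * ‖shiftMat n‖ ≤ 1 := by
    rw [← Matrix.l2_opNorm_conjTranspose_mul_self, h, Matrix.l2_opNorm_diagonal,
      pi_norm_le_iff_of_nonneg zero_le_one]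
    intro j
    split_ifs <;> simp
  nlinarith [norm_nonneg (shiftMat n)]

theorem dMat_mul_shiftMat (hc : ∀ n, 1 < c n) (n : ℕ+) :
    dMat c n * shiftMat n * (dMat c n)⁻¹ = ((c n : ℂ)⁻¹) • shiftMat n := by
  have h0 : (c n : ℂ) ≠ 0 := by
    have := hc n
    exact_mod_cast (by linarith : c n ≠ 0)
  have h1 : dMat c n * shiftMat n = ((c n : ℂ)⁻¹) • shiftMat n * dMat c n := by
    ext i j
    simp only [dMat, Matrix.diagonal_mul, Matrix.mul_diagonal, Matrix.smul_apply, shiftMat,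
      Matrix.of_apply, smul_eq_mul]
    split_ifs with h
    · rw [h, pow_succ _ ((i : ℕ) + 1)]; field_simp
    · simp
  rw [h1, Matrix.mul_assoc, Matrix.mul_nonsing_inv _ (isUnit_det_dMat hc n), mul_one]

theorem norm_twist_shiftMat_le (hc : ∀ n, 1 < c n) (n : ℕ+) : ‖twist c n (shiftMat n)‖ ≤ 1 := by
  rw [Prod.norm_def]
  refine max_le (norm_shiftMat_le n) ?_
  simp only [twist]
  rw [dMat_mul_shiftMat hc, norm_smul, norm_inv, Complex.norm_real, Real.norm_eq_abs]
  have hn := hc n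
  have h1 : |c n|⁻¹ ≤ 1 := by
    rw [abs_of_pos (by linarith)]
    exact inv_le_one_of_one_le₀ hn.le
  calc |c n|⁻¹ * ‖shiftMat n‖ ≤ 1 * 1 :=
        mul_le_mul h1 (norm_shiftMat_le n) (norm_nonneg _) zero_le_one
    _ = 1 := one_mul 1

theorem norm_twist_uMat_le (hc : ∀ n, 1 < c n) (n k : ℕ+) : ‖twist c n (uMat n k)‖ ≤ 1 := by
  rw [uMat]
  split_ifs with h
  · rw [twist_smul, twist_sum, norm_smul, norm_inv, Complex.norm_natCast]
    have hs : ‖∑ i ∈ intInterval n k, twist c n (shiftMat n ^ i)‖ ≤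
        ((intInterval n k).card : ℝ) := by
      refine (norm_sum_le_of_le (f := fun i => twist c n (shiftMat n ^ i)) (n := fun _ => (1 : ℝ))
        _ fun i _ => ?_).trans (by simp)
      rw [twist_pow hc]
      exact (norm_pow_le _ i).trans (pow_le_one₀ (norm_nonneg _) (norm_twist_shiftMat_le hc n))
    calc ((intInterval n k).card : ℝ)⁻¹ * ‖∑ i ∈ intInterval n k, twist c n (shiftMat n ^ i)‖
        ≤ ((intInterval n k).card : ℝ)⁻¹ * ((intInterval n k).card : ℝ) :=
          mul_le_mul_of_nonneg_left hs (by positivity)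
      _ ≤ 1 := inv_mul_le_one
  · rw [twist_one hc, norm_one]

end Helpers

/-- The algebra `N` of all tuples `((x_n, d_n x_n d_n⁻¹))_n` in `M`. The norm `p` of `N` is the norm
inherited from `M`. -/
def algN (c : ℕ+ → ℝ) (hc : ∀ n, 1 < c n) : NonUnitalSubalgebra ℂ BigM where
  carrier := {a | ∀ n, ∃ x : Mat n, a n = twist c n x}
  add_mem' := by
    intro a b ha hb n
    obtain ⟨x, hx⟩ := ha n
    obtain ⟨y, hy⟩ := hb n
    exact ⟨x + y, by rw [twist_add, ← hx, ← hy]; rfl⟩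
  zero_mem' := fun n => ⟨0, by rw [twist_zero]; rfl⟩
  mul_mem' := by
    intro a b ha hb n
    obtain ⟨x, hx⟩ := ha n
    obtain ⟨y, hy⟩ := hb n
    exact ⟨x * y, by rw [twist_mul hc, ← hx, ← hy]; rfl⟩
  smul_mem' := by
    intro z a ha n
    obtain ⟨x, hx⟩ := ha n
    exact ⟨z • x, by rw [twist_smul, ← hx]; rfl⟩

/-- The element `u_k = (u_{n,k})_n` of `N`, that is, the tuple `((u_{n,k}, d_n u_{n,k} d_n⁻¹))_n`. -/
def uElt (c : ℕ+ → ℝ) (hc : ∀ n, 1 < c n) (k : ℕ+) : BigM :=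
  ⟨fun n => twist c n (uMat n k), memℓp_infty ⟨1, by
    rintro _ ⟨n, rfl⟩
    exact norm_twist_uMat_le hc n k⟩⟩

/-- The algebra `A = {a ∈ N : p(a u_k - a) + p(u_k a - a) → 0}`. -/
def algA (c : ℕ+ → ℝ) (hc : ∀ n, 1 < c n) : NonUnitalSubalgebra ℂ BigM where
  carrier := {a | a ∈ algN c hc ∧
    Tendsto (fun k => ‖a * uElt c hc k - a‖ + ‖uElt c hc k * a - a‖) atTop (𝓝 0)}
  add_mem' := by
    rintro a b ⟨ha, ha'⟩ ⟨hb, hb'⟩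
    refine ⟨add_mem ha hb, squeeze_zero (fun k => by positivity) (fun k => ?_)
      (by simpa using ha'.add hb')⟩
    have h1 : (a + b) * uElt c hc k - (a + b) =
        (a * uElt c hc k - a) + (b * uElt c hc k - b) := by rw [add_mul]; abel
    have h2 : uElt c hc k * (a + b) - (a + b) =
        (uElt c hc k * a - a) + (uElt c hc k * b - b) := by rw [mul_add]; abel
    rw [h1, h2]
    linarith [norm_add_le (a * uElt c hc k - a) (b * uElt c hc k - b),
      norm_add_le (uElt c hc k * a - a) (uElt c hc k * b - b)]
  zero_mem' := ⟨zero_mem _, by simp⟩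
  mul_mem' := by
    rintro a b ⟨ha, ha'⟩ ⟨hb, hb'⟩
    refine ⟨mul_mem ha hb, squeeze_zero (fun k => by positivity) (fun k => ?_)
      (by simpa using (hb'.const_mul ‖a‖).add (ha'.mul_const ‖b‖))⟩
    have h1 : a * b * uElt c hc k - a * b = a * (b * uElt c hc k - b) := by
      rw [mul_sub, mul_assoc]
    have h2 : uElt c hc k * (a * b) - a * b = (uElt c hc k * a - a) * b := by
      rw [sub_mul, mul_assoc]
    rw [h1, h2]
    have h3 := norm_mul_le a (b * uElt c hc k - b)
    have h4 := norm_mul_le (uElt c hc k * a - a) b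
    have h5 := mul_nonneg (norm_nonneg a) (norm_nonneg (uElt c hc k * b - b))
    have h6 := mul_nonneg (norm_nonneg (a * uElt c hc k - a)) (norm_nonneg b)
    linarith
  smul_mem' := by
    rintro z a ⟨ha, ha'⟩
    refine ⟨SMulMemClass.smul_mem z ha, squeeze_zero (fun k => by positivity) (fun k => ?_)
      (by simpa using ha'.const_mul ‖z‖)⟩
    rw [smul_mul_assoc, mul_smul_comm, ← smul_sub, ← smul_sub, norm_smul, norm_smul, mul_add]

/-- The underlying type of the algebra `A`, with its algebra structure. -/
def AlgA (c : ℕ+ → ℝ) (hc : ∀ n, 1 < c n) : Type := {a : BigM // a ∈ algA c hc}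

instance (c : ℕ+ → ℝ) (hc : ∀ n, 1 < c n) : NonUnitalRing (AlgA c hc) :=
  NonUnitalSubalgebra.toNonUnitalRing (algA c hc)

instance (c : ℕ+ → ℝ) (hc : ∀ n, 1 < c n) : Module ℂ (AlgA c hc) :=
  NonUnitalSubalgebra.instModule (S := algA c hc)

/-- The inclusion of `A` in `M`. -/
def AlgA.incl (c : ℕ+ → ℝ) (hc : ∀ n, 1 < c n) (a : AlgA c hc) : BigM := a.1

/-- `A_00`: the finitely supported tuples in `N`. -/
def finSupp (c : ℕ+ → ℝ) (hc : ∀ n, 1 < c n) : Set BigM :=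
  {a | a ∈ algN c hc ∧ {n | a n ≠ 0}.Finite}

theorem single_twist_mem (c : ℕ+ → ℝ) (hc : ∀ n, 1 < c n) (n : ℕ+) (x : Mat n) :
    (lp.single ∞ n (twist c n x) : BigM) ∈ algA c hc := by
  classical
  refine ⟨fun m => ?_, ?_⟩
  · by_cases h : m = n
    · subst h
      exact ⟨x, by simp⟩
    · exact ⟨0, by rw [twist_zero]; exact Pi.single_eq_of_ne h _⟩
  · refine tendsto_const_nhds.congr' ?_
    filter_upwards [eventually_gt_atTop n] with k hk
    have hu : (uElt c hc k : ∀ m, Mat m × Mat m) n = 1 := by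
      change twist c n (uMat n k) = 1
      rw [uMat, if_neg (not_le.mpr hk), twist_one hc]
    have h1 : (lp.single ∞ n (twist c n x) : BigM) * uElt c hc k = lp.single ∞ n (twist c n x) := by
      ext1
      funext m
      rw [lp.infty_coeFn_mul, Pi.mul_apply]
      by_cases h : m = n
      · subst h; rw [hu, mul_one]
      · simp [Pi.single_eq_of_ne h]
    have h2 : uElt c hc k * (lp.single ∞ n (twist c n x) : BigM) = lp.single ∞ n (twist c n x) := by
      ext1
      funext m
      rw [lp.infty_coeFn_mul, Pi.mul_apply]
      by_cases h : m = n
      · subst h; rw [hu, one_mul]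
      · simp [Pi.single_eq_of_ne h]
    rw [h1, h2]
    simp

/-- The canonical copy in `A` of a matrix `x ∈ M_n`: the tuple with `n`-th entry
`(x, d_n x d_n⁻¹)` and all other entries zero. -/
def blockCopy (c : ℕ+ → ℝ) (hc : ∀ n, 1 < c n) (n : ℕ+) (x : Mat n) : AlgA c hc :=
  ⟨lp.single ∞ n (twist c n x), single_twist_mem c hc n x⟩

end

/-! The crux is that for every `u` in `A` the blocks of `1 - u` are invertible for all but finitely
many `n`, with inverses bounded uniformly in both coordinates. Fix `k` with `u * u_k` close to `u`,
and let `x` be the `n`-th block of `u`, with `n` large.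

In the second coordinate, conjugation by `d_n` multiplies `L_n ^ i` by `c_n ^ (-i)`, so the
conjugate of `u_{n,k}` tends to zero. The conjugate of `x` is therefore small, and a Neumann series
applies. In the first coordinate, boundedness of `d_n x d_n⁻¹` forces the strictly lower triangular
part of `x` to be of size `1 / (c_n - 1)`. The remaining upper triangular part is close to its
product with `u_{n,k}`, which is nilpotent of order `k` because its entries start `n / k` places
above the diagonal. Up to small errors `1 - x` is thus `1 - q` with `q ^ k = 0`, and the finite
geometric series bounds the inverse in terms of `‖u‖` and `k` alone
(`exists_inverse_one_sub_block`).

Consequently a modular one-sided ideal containing every block is all of `A`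
(`eq_top_of_blockCopy_mem`). A proper one misses part of some block, and its trace on that `M_n` is
a proper one-sided ideal, annihilated by a minimal idempotent. The annihilator of the canonical copy
of that idempotent is proper, modular and contains the given ideal, so maximality gives equality.
The converse and the description of the socle are algebra inside a single block. -/

/-! ### Inverting upper triangular matrices that are close to nilpotent -/

/-- If `‖r‖ ≤ 1/2`, then `1 - r` has a two-sided inverse of norm at most `2`. -/
theorem exists_inverse_one_sub {R : Type*} [NormedRing R] [NormOneClass R] [CompleteSpace R]
    (r : R) (hr : ‖r‖ ≤ 1 / 2) :
    ∃ v : R, v * (1 - r) = 1 ∧ (1 - r) * v = 1 ∧ ‖v‖ ≤ 2 := by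
  have hlt : ‖r‖ < 1 := by linarith
  refine ⟨∑' i : ℕ, r ^ i, geom_series_mul_neg r hlt, mul_neg_geom_series r hlt, ?_⟩
  refine (tsum_geometric_le_of_norm_lt_one r hlt).trans ?_
  rw [norm_one, sub_self, zero_add]
  exact (inv_anti₀ (by norm_num) (by linarith : (1 / 2 : ℝ) ≤ 1 - ‖r‖)).trans (by norm_num)

/-- Inverting a product of two invertible elements. -/
theorem mul_inverse_of_factor {R : Type*} [Ring R] {a b v w : R}
    (h1 : v * a = 1) (h2 : a * v = 1) (h3 : w * b = 1) (h4 : b * w = 1) :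
    (w * v) * (a * b) = 1 ∧ (a * b) * (w * v) = 1 := by
  constructor
  · rw [mul_assoc, ← mul_assoc v, h1, one_mul, h3]
  · rw [mul_assoc, ← mul_assoc b, h4, one_mul, h2]

section UpperTriangular

variable {n : ℕ+}

/-- The entry `(i, j)` of `x` vanishes unless `i + m ≤ j`. -/
def IsUpperBand (m : ℕ) (x : Mat n) : Prop :=
  ∀ i j : Fin n, (j : ℕ) < (i : ℕ) + m → x i j = 0

namespace IsUpperBand

variable {l m : ℕ} {x y : Mat n}

theorem one : IsUpperBand 0 (1 : Mat n) := fun i j h =>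
  Matrix.one_apply_ne fun e => by subst e; omega

theorem mono (hx : IsUpperBand m x) (h : l ≤ m) : IsUpperBand l x := fun i j hij =>
  hx i j (by omega)

theorem sub (hx : IsUpperBand m x) (hy : IsUpperBand m y) : IsUpperBand m (x - y) :=
  fun i j h => by rw [Matrix.sub_apply, hx i j h, hy i j h, sub_zero]

theorem smul (z : ℂ) (hx : IsUpperBand m x) : IsUpperBand m (z • x) :=
  fun i j h => by rw [Matrix.smul_apply, hx i j h, smul_zero]

theorem sum {s : Finset ℕ} {f : ℕ → Mat n} (hf : ∀ i ∈ s, IsUpperBand m (f i)) :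
    IsUpperBand m (∑ i ∈ s, f i) := fun i j h => by
  rw [Matrix.sum_apply]
  exact Finset.sum_eq_zero fun k hk => hf k hk i j h

theorem mul (hx : IsUpperBand l x) (hy : IsUpperBand m y) : IsUpperBand (l + m) (x * y) := by
  intro i j h
  rw [Matrix.mul_apply]
  refine Finset.sum_eq_zero fun k _ => ?_
  by_cases hk : (k : ℕ) < (i : ℕ) + l
  · rw [hx i k hk, zero_mul]
  · rw [hy k j (by omega), mul_zero]

theorem pow (hx : IsUpperBand m x) (k : ℕ) : IsUpperBand (k * m) (x ^ k) := by
  induction k with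
  | zero => simpa using one
  | succ k ih => rw [pow_succ, Nat.succ_mul]; exact ih.mul hx

theorem eq_zero (hx : IsUpperBand m x) (h : (n : ℕ) ≤ m) : x = 0 := by
  ext i j
  exact hx i j (by have := j.isLt; omega)

/-- Multiplying by such an inverse does not narrow the band of zeros of the other factor. -/
theorem of_mul_eq_one (hx : IsUpperBand 0 x) (h : y * x = 1) : IsUpperBand 0 y := by
  let _ : Invertible x := ⟨y, h, mul_eq_one_comm.mp h⟩
  have hb : x.BlockTriangular id := fun i j hij => hx i j (by simpa using hij)
  have := Matrix.blockTriangular_inv_of_blockTriangular hb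
  rw [Matrix.inv_eq_left_inv h] at this
  exact fun i j hij => this (show j < i by simpa using hij)

end IsUpperBand

theorem shiftMat_pow_apply (l : ℕ) (i j : Fin n) :
    (shiftMat n ^ l) i j = if (j : ℕ) = (i : ℕ) + l then 1 else 0 := by
  induction l generalizing i with
  | zero => simp [Matrix.one_apply, Fin.ext_iff, eq_comm]
  | succ l ih =>
    rw [pow_succ', Matrix.mul_apply]
    have h1 : ∀ b : Fin n, shiftMat n i b = if (b : ℕ) = (i : ℕ) + 1 then 1 else 0 := fun _ => rfl
    simp only [ih, h1, ite_mul, one_mul, zero_mul]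
    by_cases h : (i : ℕ) + 1 < n
    · rw [Finset.sum_eq_single (⟨i + 1, h⟩ : Fin n)]
      · simp [add_assoc, add_comm 1 l]
      · intro b _ hb
        exact if_neg fun e => hb (Fin.ext e)
      · simp
    · have := j.isLt
      rw [if_neg (by omega)]
      refine Finset.sum_eq_zero fun b _ => if_neg ?_
      have := b.isLt
      omega

theorem isUpperBand_shiftMat_pow (l : ℕ) : IsUpperBand l (shiftMat n ^ l) := fun i j h => by
  rw [shiftMat_pow_apply, if_neg (by omega)]

theorem norm_shiftMat_pow_le (l : ℕ) : ‖shiftMat n ^ l‖ ≤ 1 :=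
  (norm_pow_le _ l).trans (pow_le_one₀ (norm_nonneg _) (norm_shiftMat_le n))

/-- Only powers with exponent at least `n / k` are averaged. Any product of `k` matrices with this
band vanishes, since the widths add up to at least `n`. -/
theorem isUpperBand_uMat {k : ℕ+} (h : k ≤ n) :
    IsUpperBand ⌈(n : ℚ) / (k : ℚ)⌉₊ (uMat n k) := by
  rw [uMat, if_pos h]
  refine (IsUpperBand.sum fun i hi => ?_).smul _
  exact (isUpperBand_shiftMat_pow i).mono (Finset.mem_Icc.mp hi).1

/-- Bound for the norm of the inverse in `exists_inverse_one_sub_upper`. -/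
noncomputable def inverseBound (K : ℝ) (k : ℕ) : ℝ := (∑ j ∈ Finset.range k, (2 * K) ^ j) * 2

/-- If `x` is upper triangular and close to `x * u`, where `u` is upper triangular and nilpotent
of order `k`, then `1 - x` is invertible with a bound depending only on `k` and the norms. -/
theorem exists_inverse_one_sub_upper {K : ℝ} {m k : ℕ} (hmk : (n : ℕ) ≤ k * m)
    {x u : Mat n} (hx : IsUpperBand 0 x) (hu : IsUpperBand m u) (hxK : ‖x‖ ≤ K) (hu1 : ‖u‖ ≤ 1)
    (hxu : ‖x - x * u‖ ≤ 1 / 2) :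
    ∃ v : Mat n, v * (1 - x) = 1 ∧ (1 - x) * v = 1 ∧ ‖v‖ ≤ inverseBound K k := by
  obtain ⟨w, hw1, hw2, hw⟩ := exists_inverse_one_sub (x - x * u) hxu
  have hxu0 : IsUpperBand m (x * u) := by simpa using hx.mul hu
  have hw0 : IsUpperBand 0 w :=
    (IsUpperBand.one.sub (hx.sub (hxu0.mono m.zero_le))).of_mul_eq_one hw1
  -- With `r = x - x * u` and `w` inverse to `1 - r`, one has `1 - x = (1 - r) - x * u = (1 - r) *
  -- (1 - q)`. As `w` is upper triangular, `q` keeps the band of `u` and is nilpotent.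
  set q := w * (x * u) with hq
  have hqm : IsUpperBand m q := by simpa using hw0.mul hxu0
  have hqk : q ^ k = 0 := (hqm.pow k).eq_zero hmk
  have hK : 0 ≤ K := (norm_nonneg _).trans hxK
  have hxu' : ‖x * u‖ ≤ K := (norm_mul_le _ _).trans
    ((mul_le_mul hxK hu1 (norm_nonneg _) hK).trans_eq (mul_one K))
  have hqn : ‖q‖ ≤ 2 * K := (norm_mul_le _ _).trans
    (mul_le_mul hw hxu' (norm_nonneg _) zero_le_two)
  have hfac : 1 - x = (1 - (x - x * u)) * (1 - q) := by
    rw [hq, mul_sub, ← mul_assoc _ w, hw2, one_mul, mul_one]; abel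
  have h1 : (∑ j ∈ Finset.range k, q ^ j) * (1 - q) = 1 := by
    rw [geom_sum_mul_neg, hqk, sub_zero]
  have h2 : (1 - q) * (∑ j ∈ Finset.range k, q ^ j) = 1 := by
    rw [mul_neg_geom_sum, hqk, sub_zero]
  obtain ⟨h3, h4⟩ := mul_inverse_of_factor hw1 hw2 h1 h2
  refine ⟨_, hfac ▸ h3, hfac ▸ h4, (norm_mul_le _ _).trans ?_⟩
  refine mul_le_mul ?_ hw (norm_nonneg _) (by positivity)
  refine norm_sum_le_of_le _ fun j _ => (norm_pow_le _ j).trans ?_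
  exact pow_le_pow_left₀ (norm_nonneg _) hqn j

/-! ### Lower triangular parts -/

/-- The strictly lower triangular part of a matrix. -/
def lowerPart (x : Mat n) : Mat n := Matrix.of fun i j => if j < i then x i j else 0

theorem isUpperBand_sub_lowerPart (x : Mat n) : IsUpperBand 0 (x - lowerPart x) := by
  intro i j h
  have : j < i := by simpa using h
  simp [lowerPart, this]

theorem norm_entry_le_l2_opNorm (x : Mat n) (i j : Fin n) : ‖x i j‖ ≤ ‖x‖ := by
  have h := Matrix.l2_opNorm_mulVec x (EuclideanSpace.single j (1 : ℂ))
  rw [PiLp.norm_single, norm_one, mul_one] at h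
  refine le_trans ?_ ((PiLp.norm_apply_le _ i).trans h)
  simp

variable {c : ℕ+ → ℝ}

theorem twist_sub (x y : Mat n) : twist c n (x - y) = twist c n x - twist c n y := by
  simp [twist, mul_sub, sub_mul]

theorem dMat_conj_apply (hc : ∀ n, 1 < c n) (x : Mat n) (i j : Fin n) :
    (dMat c n * x * (dMat c n)⁻¹) i j =
      (c n : ℂ) ^ ((i : ℕ) + 1) * x i j / (c n : ℂ) ^ ((j : ℕ) + 1) := by
  have h0 : (c n : ℂ) ≠ 0 := by
    have := hc n
    exact_mod_cast (by linarith : c n ≠ 0)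
  have h : dMat c n * x * (dMat c n)⁻¹ * dMat c n = dMat c n * x := by
    rw [Matrix.mul_assoc, Matrix.nonsing_inv_mul _ (isUnit_det_dMat hc n), mul_one]
  have := congrFun (congrFun h i) j
  simp only [dMat, Matrix.mul_diagonal, Matrix.diagonal_mul] at this
  rw [eq_div_iff (pow_ne_zero _ h0)]
  exact this

/-- A single subdiagonal is a contraction times a diagonal matrix, so its operator norm is
controlled by its largest entry. -/
theorem norm_transpose_shiftMat_pow_mul_diagonal_le (l : ℕ) (g : Fin n → ℂ) {K : ℝ} (hK : 0 ≤ K)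
    (hg : ∀ j, ‖g j‖ ≤ K) : ‖(shiftMat n ^ l).conjTranspose * Matrix.diagonal g‖ ≤ K := by
  refine (norm_mul_le _ _).trans ?_
  rw [Matrix.l2_opNorm_conjTranspose, Matrix.l2_opNorm_diagonal]
  calc _ ≤ 1 * K := mul_le_mul (norm_shiftMat_pow_le l)
        ((pi_norm_le_iff_of_nonneg hK).mpr hg) (norm_nonneg _) zero_le_one
    _ = K := one_mul K

/-- On the subdiagonal `i - j = l + 1`, conjugation by `d_n` multiplies entries by `c_n ^ (l + 1)`;
this is undone here one subdiagonal at a time. The value `0` fills the columns that the subdiagonal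
does not reach. -/
theorem lowerPart_eq_sum (hc : ∀ n, 1 < c n) (x : Mat n) :
    lowerPart x = ∑ l ∈ Finset.range n, ((c n : ℂ)⁻¹) ^ (l + 1) •
      ((shiftMat n ^ (l + 1)).conjTranspose * Matrix.diagonal fun j : Fin n =>
        if h : (j : ℕ) + (l + 1) < n then
          (dMat c n * x * (dMat c n)⁻¹) ⟨j + (l + 1), h⟩ j else 0) := by
  have h0 : (c n : ℂ) ≠ 0 := by
    have := hc n
    exact_mod_cast (by linarith : c n ≠ 0)
  ext i j
  simp only [Matrix.sum_apply, Matrix.smul_apply, Matrix.mul_diagonal, Matrix.conjTranspose_apply,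
    shiftMat_pow_apply, lowerPart, Matrix.of_apply, smul_eq_mul]
  by_cases hji : j < i
  · have hji' : (j : ℕ) < i := hji
    have hi := i.isLt
    rw [if_pos hji, Finset.sum_eq_single ((i : ℕ) - j - 1)]
    · have e : (j : ℕ) + ((i : ℕ) - j - 1 + 1) = i := by omega
      have e' : (⟨(j : ℕ) + ((i : ℕ) - j - 1 + 1), by omega⟩ : Fin n) = i := Fin.ext e
      rw [dif_pos (by omega), e', if_pos e.symm, star_one, one_mul, dMat_conj_apply hc]
      have e2 : (i : ℕ) + 1 = ((i : ℕ) - j - 1 + 1) + (j + 1) := by omega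
      rw [e2, pow_add (c n : ℂ) _ ((j : ℕ) + 1)]
      rw [inv_pow]
      field_simp
    · intro l _ hl
      rw [if_neg (by omega)]; simp
    · intro h
      exact absurd (Finset.mem_range.mpr (by omega)) h
  · have hji' : ¬ (j : ℕ) < i := hji
    rw [if_neg hji]
    refine (Finset.sum_eq_zero fun l _ => ?_).symm
    rw [if_neg (by omega)]; simp

/-- The subdiagonals contribute at most `K * c_n ^ (-(l + 1))` each, and the geometric series sums
to `K / (c_n - 1)`. -/
theorem norm_lowerPart_le (hc : ∀ n, 1 < c n) (x : Mat n) {K : ℝ}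
    (hK : ‖dMat c n * x * (dMat c n)⁻¹‖ ≤ K) : ‖lowerPart x‖ ≤ K / (c n - 1) := by
  have hK0 : 0 ≤ K := (norm_nonneg _).trans hK
  have hcn := hc n
  have hpos : 0 < c n := by linarith
  set r := (c n)⁻¹ with hr
  have hr0 : 0 ≤ r := by positivity
  have hr1 : r < 1 := inv_lt_one_of_one_lt₀ hcn
  rw [lowerPart_eq_sum hc]
  have hterm : ∀ l ∈ Finset.range (n : ℕ), ‖((c n : ℂ)⁻¹) ^ (l + 1) •
      ((shiftMat n ^ (l + 1)).conjTranspose * Matrix.diagonal fun j : Fin n =>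
        if h : (j : ℕ) + (l + 1) < n then
          (dMat c n * x * (dMat c n)⁻¹) ⟨j + (l + 1), h⟩ j else 0)‖ ≤ r ^ (l + 1) * K := by
    intro l _
    rw [norm_smul, norm_pow, norm_inv, Complex.norm_real, Real.norm_of_nonneg hpos.le]
    refine mul_le_mul_of_nonneg_left ?_ (by positivity)
    refine norm_transpose_shiftMat_pow_mul_diagonal_le _ _ hK0 fun j => ?_
    split_ifs
    · exact (norm_entry_le_l2_opNorm _ _ _).trans hK
    · simpa using hK0
  refine (norm_sum_le_of_le _ hterm).trans ?_
  have hsum : ∑ l ∈ Finset.range (n : ℕ), r ^ (l + 1) * K =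
      (∑ l ∈ Finset.range (n : ℕ), r ^ l) * (r * K) := by
    rw [Finset.sum_mul]
    exact Finset.sum_congr rfl fun l _ => by ring
  rw [hsum]
  have hg : ∑ l ∈ Finset.range (n : ℕ), r ^ l ≤ (1 - r)⁻¹ := by
    rw [← tsum_geometric_of_lt_one hr0 hr1]
    exact (summable_geometric_of_lt_one hr0 hr1).sum_le_tsum _ fun _ _ => by positivity
  refine (mul_le_mul_of_nonneg_right hg (by positivity)).trans_eq ?_
  have : c n - 1 ≠ 0 := by linarith
  have : 1 - (c n)⁻¹ ≠ 0 := by rw [← hr]; linarith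
  rw [hr]
  field_simp

/-! ### Uniform inversion of `1 - x` in a large block -/

theorem norm_conj_uMat_le (hc : ∀ n, 1 < c n) {k : ℕ+} (h : k ≤ n) :
    ‖dMat c n * uMat n k * (dMat c n)⁻¹‖ ≤ (c n)⁻¹ := by
  have hcn := hc n
  have hpos : 0 < c n := by linarith
  have hpow : ∀ i : ℕ, dMat c n * shiftMat n ^ i * (dMat c n)⁻¹ =
      ((c n : ℂ)⁻¹) ^ i • shiftMat n ^ i := fun i => by
    have : dMat c n * shiftMat n ^ i * (dMat c n)⁻¹ =
        (dMat c n * shiftMat n * (dMat c n)⁻¹) ^ i := congrArg Prod.snd (twist_pow hc n (shiftMat n) i)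
    rw [this, dMat_mul_shiftMat hc, smul_pow]
  have hterm : ∀ i ∈ intInterval n k,
      ‖dMat c n * shiftMat n ^ i * (dMat c n)⁻¹‖ ≤ (c n)⁻¹ := by
    intro i hi
    -- The identity is not among the averaged powers, so each conjugated term gains at least one
    -- factor `(c n)⁻¹`.
    have hi1 : 1 ≤ i := by
      refine le_trans ?_ (Finset.mem_Icc.mp hi).1
      rw [Nat.one_le_ceil_iff]
      have := n.pos; have := k.pos
      positivity
    rw [hpow, norm_smul, norm_pow, norm_inv, Complex.norm_real, Real.norm_of_nonneg hpos.le]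
    calc _ ≤ (c n)⁻¹ ^ 1 * 1 := mul_le_mul
          (pow_le_pow_of_le_one (by positivity) (inv_le_one_of_one_le₀ hcn.le) hi1)
          (norm_shiftMat_pow_le i) (norm_nonneg _) (by positivity)
      _ = _ := by rw [pow_one, mul_one]
  rw [uMat, if_pos h, mul_smul_comm, smul_mul_assoc, Finset.mul_sum, Finset.sum_mul, norm_smul,
    norm_inv, Complex.norm_natCast]
  calc _ ≤ ((intInterval n k).card : ℝ)⁻¹ * ((intInterval n k).card * (c n)⁻¹) := by
        refine mul_le_mul_of_nonneg_left ?_ (by positivity)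
        refine (norm_sum_le_of_le _ hterm).trans (by simp)
    _ ≤ 1 * (c n)⁻¹ := by
        rw [← mul_assoc]
        exact mul_le_mul_of_nonneg_right inv_mul_le_one (by positivity)
    _ = _ := one_mul _

/-- A uniform invertibility criterion for `1 - x` in the `n`-th block. -/
theorem exists_inverse_one_sub_block (hc : ∀ n, 1 < c n) {K : ℝ} {k : ℕ+} (h : k ≤ n) {x : Mat n}
    (hK : ‖twist c n x‖ ≤ K)
    (hxu : ‖twist c n x * twist c n (uMat n k) - twist c n x‖ ≤ 1 / 8)
    (h1 : K / (c n - 1) ≤ 1 / 8)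
    (h2 : K / (c n - 1) * inverseBound (K + 1) k ≤ 1 / 2) :
    ∃ v : Mat n, v * (1 - x) = 1 ∧ (1 - x) * v = 1 ∧
      ‖twist c n v‖ ≤ max (2 * inverseBound (K + 1) k) 2 := by
  have hcn := hc n
  have hK0 : 0 ≤ K := (norm_nonneg _).trans hK
  have hx1 : ‖x‖ ≤ K := (norm_fst_le _).trans hK
  have hx2 : ‖dMat c n * x * (dMat c n)⁻¹‖ ≤ K := (norm_snd_le _).trans hK
  have hu1 : ‖uMat n k‖ ≤ 1 := (norm_fst_le _).trans (norm_twist_uMat_le hc n k)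
  have hxu1 : ‖x * uMat n k - x‖ ≤ 1 / 8 := (norm_fst_le _).trans hxu
  have hxu2 : ‖dMat c n * x * (dMat c n)⁻¹ * (dMat c n * uMat n k * (dMat c n)⁻¹) -
      dMat c n * x * (dMat c n)⁻¹‖ ≤ 1 / 8 := (norm_snd_le _).trans hxu
  set low := lowerPart x with hlow
  have hl : ‖low‖ ≤ K / (c n - 1) := norm_lowerPart_le hc x hx2
  have hl8 : ‖low‖ ≤ 1 / 8 := hl.trans h1
  have hup : ‖x - low‖ ≤ K + 1 := (norm_sub_le _ _).trans (by linarith)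
  have hlu : ‖low * uMat n k‖ ≤ 1 / 8 := (norm_mul_le _ _).trans
    (by nlinarith [norm_nonneg low, norm_nonneg (uMat n k)])
  -- Three errors of size `1 / 8`: that of `x`, and the terms `low` and `low * uMat n k`.
  have hR : ‖(x - low) - (x - low) * uMat n k‖ ≤ 1 / 2 := by
    have e : (x - low) - (x - low) * uMat n k =
        (low * uMat n k - low) - (x * uMat n k - x) := by rw [sub_mul]; abel
    rw [e]
    linarith [norm_sub_le (low * uMat n k - low) (x * uMat n k - x),
      norm_sub_le (low * uMat n k) low]
  have hmk : (n : ℕ) ≤ k * ⌈(n : ℚ) / (k : ℚ)⌉₊ := by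
    have hk : (0 : ℚ) < k := by exact_mod_cast k.pos
    have := Nat.le_ceil ((n : ℚ) / (k : ℚ))
    rw [div_le_iff₀ hk] at this
    rw [mul_comm]
    exact_mod_cast this
  obtain ⟨v, hv1, hv2, hv⟩ := exists_inverse_one_sub_upper hmk (isUpperBand_sub_lowerPart x)
    (isUpperBand_uMat h) hup hu1 hR
  -- The lower part is restored as a perturbation: `1 - x = (1 - (x - low)) * (1 - v * low)`. Since
  -- the bound on `v` does not depend on `n`, the product is small once `c n` is large.
  have hvl : ‖v * low‖ ≤ 1 / 2 := by
    refine (norm_mul_le _ _).trans (le_trans ?_ h2)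
    rw [mul_comm]
    exact mul_le_mul hl hv (norm_nonneg _) ((norm_nonneg _).trans hl)
  obtain ⟨w, hw1, hw2, hw⟩ := exists_inverse_one_sub (v * low) hvl
  have hfac : 1 - x = (1 - (x - low)) * (1 - v * low) := by
    rw [mul_sub, ← mul_assoc _ v, hv2, mul_one, one_mul]; abel
  obtain ⟨h3, h4⟩ := mul_inverse_of_factor hv1 hv2 hw1 hw2
  rw [← hfac] at h3 h4
  refine ⟨w * v, h3, h4, max_le_max ?_ ?_⟩
  · exact (norm_mul_le _ _).trans (mul_le_mul hw hv (norm_nonneg _) zero_le_two)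
  -- Conjugating `w * v` directly would give no bound. Instead `y` itself is small, and by
  -- uniqueness of inverses the conjugate of `w * v` is the Neumann inverse of `1 - y`.
  · set y := dMat c n * x * (dMat c n)⁻¹ with hy
    have hyu : ‖y * (dMat c n * uMat n k * (dMat c n)⁻¹)‖ ≤ 1 / 8 := by
      refine (norm_mul_le _ _).trans (le_trans ?_ h1)
      have hle : (c n)⁻¹ ≤ (c n - 1)⁻¹ := inv_anti₀ (by linarith) (by linarith)
      exact mul_le_mul hx2 ((norm_conj_uMat_le hc h).trans hle) (norm_nonneg _) hK0
    have hyn : ‖y‖ ≤ 1 / 2 := by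
      have := norm_sub_le (y * (dMat c n * uMat n k * (dMat c n)⁻¹))
        (y * (dMat c n * uMat n k * (dMat c n)⁻¹) - y)
      rw [sub_sub_cancel] at this
      linarith
    obtain ⟨t, ht1, ht2, ht⟩ := exists_inverse_one_sub y hyn
    have hinv : twist c n (w * v) * (twist c n 1 - twist c n x) = 1 := by
      rw [← twist_sub, ← twist_mul hc, h3, twist_one hc]
    rw [twist_one hc] at hinv
    have hinv2 : (twist c n (w * v)).2 * (1 - y) = 1 := congrArg Prod.snd hinv
    rw [left_inv_eq_right_inv hinv2 ht2]
    exact ht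

end UpperTriangular

/-! ### Idempotents and one-sided ideals in a complex algebra -/

section General

variable {A : Type*} [NonUnitalRing A]

/-- Replaces `(1 - e)A` by an annihilator, in which membership is a single equation. -/
theorem range_sub_mul_eq {e : A} (he : e * e = e) :
    (Set.range fun a : A => a - e * a) = {a | e * a = 0} := by
  ext a
  constructor
  · rintro ⟨b, rfl⟩
    simp [mul_sub, ← mul_assoc, he]
  · intro h
    exact ⟨a, by simp [show e * a = 0 from h]⟩

theorem range_sub_mul_eq' {e : A} (he : e * e = e) :
    (Set.range fun a : A => a - a * e) = {a | a * e = 0} := by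
  ext a
  constructor
  · rintro ⟨b, rfl⟩
    simp [sub_mul, mul_assoc, he]
  · intro h
    exact ⟨a, by simp [show a * e = 0 from h]⟩

variable [Module ℂ A]

section Right

variable [SMulCommClass ℂ A A]

/-- The right annihilator `{a | e * a = 0}`. -/
def rightAnnihilator (e : A) : Submodule ℂ A := LinearMap.ker (LinearMap.mulLeft ℂ e)

@[simp] theorem mem_rightAnnihilator {e a : A} : a ∈ rightAnnihilator e ↔ e * a = 0 := Iff.rfl

theorem isMinimalRightIdeal_range_mulLeft {e : A} (he0 : e ≠ 0) (he : e * e = e)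
    (h : ∀ b, e * b ≠ 0 → ∃ y, e * b * y = e) :
    IsMinimalRightIdeal (LinearMap.range (LinearMap.mulLeft ℂ e)) := by
  refine ⟨⟨?_, fun hbot => he0 ?_⟩, fun K ⟨hK, hK0⟩ hle => ?_⟩
  · rintro a _ ⟨x, rfl⟩
    exact ⟨x * a, by simp [mul_assoc]⟩
  · have : e ∈ LinearMap.range (LinearMap.mulLeft ℂ e) := ⟨e, he⟩
    rwa [hbot, Submodule.mem_bot] at this
  · obtain ⟨b, hb, hb0⟩ := K.ne_bot_iff.mp hK0
    obtain ⟨x, hx⟩ := hle hb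
    rw [LinearMap.mulLeft_apply] at hx
    obtain ⟨y, hy⟩ := h x (hx ▸ hb0)
    have heK : e ∈ K := by rw [← hy, hx]; exact hK y b hb
    rintro _ ⟨a, rfl⟩
    exact hK a e heK

end Right

section Left

variable [IsScalarTower ℂ A A]

/-- The left annihilator `{a | a * e = 0}`. -/
def leftAnnihilator (e : A) : Submodule ℂ A := LinearMap.ker (LinearMap.mulRight ℂ e)

@[simp] theorem mem_leftAnnihilator {e a : A} : a ∈ leftAnnihilator e ↔ a * e = 0 := Iff.rfl

theorem isMinimalLeftIdeal_range_mulRight {e : A} (he0 : e ≠ 0) (he : e * e = e)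
    (h : ∀ b, b * e ≠ 0 → ∃ y, y * (b * e) = e) :
    IsMinimalLeftIdeal (LinearMap.range (LinearMap.mulRight ℂ e)) := by
  refine ⟨⟨?_, fun hbot => he0 ?_⟩, fun K ⟨hK, hK0⟩ hle => ?_⟩
  · rintro a _ ⟨x, rfl⟩
    exact ⟨a * x, by simp [mul_assoc]⟩
  · have : e ∈ LinearMap.range (LinearMap.mulRight ℂ e) := ⟨e, he⟩
    rwa [hbot, Submodule.mem_bot] at this
  · obtain ⟨b, hb, hb0⟩ := K.ne_bot_iff.mp hK0
    obtain ⟨x, hx⟩ := hle hb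
    rw [LinearMap.mulRight_apply] at hx
    obtain ⟨y, hy⟩ := h x (hx ▸ hb0)
    have heK : e ∈ K := by rw [← hy, hx]; exact hK y b hb
    rintro _ ⟨a, rfl⟩
    exact hK a e heK

end Left

variable [IsScalarTower ℂ A A] [SMulCommClass ℂ A A]

theorem isMinimalIdempotent_iff {e : A} :
    IsMinimalIdempotent e ↔ e ≠ 0 ∧ e * e = e ∧ ∀ a, ∃ z : ℂ, e * a * e = z • e := by
  refine and_congr_right fun _ => and_congr_right fun he => ⟨fun h a => ?_, fun h => ?_⟩
  · obtain ⟨z, hz⟩ := h.subset ⟨a, rfl⟩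
    exact ⟨z, hz.symm⟩
  · refine Set.Subset.antisymm ?_ ?_
    · rintro _ ⟨a, rfl⟩
      obtain ⟨z, hz⟩ := h a
      exact ⟨z, hz.symm⟩
    · rintro _ ⟨z, rfl⟩
      exact ⟨z • e, by simp [mul_smul_comm, smul_mul_assoc, he]⟩

theorem isModularRightIdeal_rightAnnihilator {e : A} (he0 : e ≠ 0) (he : e * e = e) :
    IsModularRightIdeal (rightAnnihilator e) ∧ rightAnnihilator e ≠ ⊤ := by
  refine ⟨⟨fun a x hx => ?_, e, fun a => ?_⟩, fun h => he0 ?_⟩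
  · rw [mem_rightAnnihilator] at hx ⊢
    rw [← mul_assoc, hx, zero_mul]
  · rw [mem_rightAnnihilator, mul_sub, ← mul_assoc, he, sub_self]
  · have : e ∈ rightAnnihilator e := h ▸ Submodule.mem_top
    rwa [mem_rightAnnihilator, he] at this

theorem isModularLeftIdeal_leftAnnihilator {e : A} (he0 : e ≠ 0) (he : e * e = e) :
    IsModularLeftIdeal (leftAnnihilator e) ∧ leftAnnihilator e ≠ ⊤ := by
  refine ⟨⟨fun a x hx => ?_, e, fun a => ?_⟩, fun h => he0 ?_⟩
  · rw [mem_leftAnnihilator] at hx ⊢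
    rw [mul_assoc, hx, mul_zero]
  · rw [mem_leftAnnihilator, sub_mul, mul_assoc, he, sub_self]
  · have : e ∈ leftAnnihilator e := h ▸ Submodule.mem_top
    rwa [mem_leftAnnihilator, he] at this

/-- A larger right ideal contains some `b` with `e * b ≠ 0`, hence `e` by `h`, hence `eA`; together
with `(1 - e)A` this is everything. -/
theorem isMaximalModularRightIdeal_rightAnnihilator {e : A} (he0 : e ≠ 0) (he : e * e = e)
    (h : ∀ b, e * b ≠ 0 → ∃ y, e * b * y = e) :
    IsMaximalModularRightIdeal (rightAnnihilator e) := by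
  refine ⟨isModularRightIdeal_rightAnnihilator he0 he, fun K ⟨⟨hK, _⟩, hKtop⟩ hle b hb => ?_⟩
  by_contra hne
  obtain ⟨y, hy⟩ := h b hne
  have hsub : ∀ a, a - e * a ∈ K := fun a => hle (by
    rw [mem_rightAnnihilator, mul_sub, ← mul_assoc, he, sub_self])
  have heb : e * b ∈ K := by simpa using K.sub_mem hb (hsub b)
  have heK : e ∈ K := hy ▸ hK y _ heb
  exact hKtop (eq_top_iff.mpr fun a _ => by simpa using K.add_mem (hsub a) (hK a e heK))

theorem isMaximalModularLeftIdeal_leftAnnihilator {e : A} (he0 : e ≠ 0) (he : e * e = e)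
    (h : ∀ b, b * e ≠ 0 → ∃ y, y * (b * e) = e) :
    IsMaximalModularLeftIdeal (leftAnnihilator e) := by
  refine ⟨isModularLeftIdeal_leftAnnihilator he0 he, fun K ⟨⟨hK, _⟩, hKtop⟩ hle b hb => ?_⟩
  by_contra hne
  obtain ⟨y, hy⟩ := h b hne
  have hsub : ∀ a, a - a * e ∈ K := fun a => hle (by
    rw [mem_leftAnnihilator, sub_mul, mul_assoc, he, sub_self])
  have heb : b * e ∈ K := by simpa using K.sub_mem hb (hsub b)
  have heK : e ∈ K := hy ▸ hK y _ heb
  exact hKtop (eq_top_iff.mpr fun a _ => by simpa using K.add_mem (hsub a) (hK a e heK))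

end General

/-! ### One-sided ideals of matrix algebras -/

section MatrixIdeals

open Matrix

variable {n : ℕ+}

theorem isMinimalIdempotent_vecMulVec {v w : Fin n → ℂ} (h : w ⬝ᵥ v = 1) :
    IsMinimalIdempotent (vecMulVec v w : Mat n) := by
  have key : ∀ x : Mat n, vecMulVec v w * x * vecMulVec v w = (w ᵥ* x ⬝ᵥ v) • vecMulVec v w := by
    intro x
    rw [vecMulVec_mul, vecMulVec_mul_vecMulVec, vecMulVec_smul]
  refine isMinimalIdempotent_iff.mpr ⟨fun h0 => ?_, ?_, fun a => ⟨_, key a⟩⟩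
  · have h1 : w ⬝ᵥ (vecMulVec v w *ᵥ v) = 1 := by
      rw [vecMulVec_mulVec, h]; simpa using h
    simp [h0] at h1
  · simpa [h] using key 1

theorem isMinimalIdempotent_single (j : Fin n) :
    IsMinimalIdempotent (Matrix.single j j 1 : Mat n) := by
  rw [single_eq_single_vecMulVec_single]
  exact isMinimalIdempotent_vecMulVec (by simp)

theorem exists_mul_mul_ne_zero {x y : Mat n} (hx : x ≠ 0) (hy : y ≠ 0) :
    ∃ z, x * z * y ≠ 0 := by
  obtain ⟨i, j, hij⟩ : ∃ i j, x i j ≠ 0 := by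
    by_contra! h
    exact hx (Matrix.ext h)
  obtain ⟨k, l, hkl⟩ : ∃ k l, y k l ≠ 0 := by
    by_contra! h
    exact hy (Matrix.ext h)
  refine ⟨Matrix.single j k 1, fun h => ?_⟩
  have := congrFun (congrFun h i) l
  rw [Matrix.mul_apply, Finset.sum_eq_single k] at this
  · simp [hij, hkl] at this
  · intro b _ hb
    simp [Matrix.mul_single_apply_of_ne, hb]
  · simp

/-- Since `M_n` is prime, `f * x * y * f` is nonzero for some `y`; being a scalar multiple of `f`,
it can be rescaled to `f`. -/
theorem IsMinimalIdempotent.exists_mul_right {f x : Mat n} (hf : IsMinimalIdempotent f)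
    (hx : f * x ≠ 0) : ∃ y, f * x * y = f := by
  obtain ⟨hf0, -, hf2⟩ := isMinimalIdempotent_iff.mp hf
  obtain ⟨y, hy⟩ := exists_mul_mul_ne_zero hx hf0
  obtain ⟨z, hz⟩ := hf2 (x * y)
  rw [mul_assoc f x y, hz] at hy
  refine ⟨z⁻¹ • (y * f), ?_⟩
  rw [mul_smul_comm, ← mul_assoc, mul_assoc f x y, hz, inv_smul_smul₀ (left_ne_zero_of_smul hy)]

theorem IsMinimalIdempotent.exists_mul_left {f x : Mat n} (hf : IsMinimalIdempotent f)
    (hx : x * f ≠ 0) : ∃ y, y * (x * f) = f := by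
  obtain ⟨hf0, -, hf2⟩ := isMinimalIdempotent_iff.mp hf
  obtain ⟨y, hy⟩ := exists_mul_mul_ne_zero hf0 hx
  obtain ⟨z, hz⟩ := hf2 (y * x)
  have e : f * y * (x * f) = z • f := by rw [← hz]; simp only [mul_assoc]
  rw [e] at hy
  refine ⟨z⁻¹ • (f * y), ?_⟩
  rw [smul_mul_assoc, e, inv_smul_smul₀ (left_ne_zero_of_smul hy)]

/-- The columns of members of a right ideal lie in the space `R` of vectors `w` all of whose
rank-one matrices `w ψᵀ` belong to `I`. When `I` is proper so is `R`, and a nonzero functional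
vanishing on `R` supplies the row of a rank-one idempotent. -/
theorem exists_minimalIdempotent_mul_eq_zero {I : Submodule ℂ (Mat n)} (hI : IsRightIdeal I)
    (htop : I ≠ ⊤) : ∃ f : Mat n, IsMinimalIdempotent f ∧ ∀ x ∈ I, f * x = 0 := by
  let R : Submodule ℂ (Fin n → ℂ) :=
    { carrier := {w | ∀ ψ, vecMulVec w ψ ∈ I}
      add_mem' := fun ha hb ψ => by rw [add_vecMulVec]; exact I.add_mem (ha ψ) (hb ψ)
      zero_mem' := fun ψ => by rw [zero_vecMulVec]; exact I.zero_mem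
      smul_mem' := fun z w hw ψ => by rw [smul_vecMulVec]; exact I.smul_mem z (hw ψ) }
  have hR : R < ⊤ := by
    refine lt_top_iff_ne_top.mpr fun h => htop (eq_top_iff.mpr fun x _ => ?_)
    have hx : x = ∑ j, vecMulVec (x.col j) (Pi.single j 1) := by
      ext a b
      simp [Matrix.sum_apply, vecMulVec_apply, Pi.single_apply]
    rw [hx]
    refine I.sum_mem fun j _ => ?_
    have : x.col j ∈ R := h ▸ Submodule.mem_top
    exact this _
  obtain ⟨φ, hφ0, hφ⟩ := Submodule.exists_le_ker_of_lt_top R hR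
  obtain ⟨v, hv⟩ : ∃ v, φ v ≠ 0 := by
    by_contra! h
    exact hφ0 (LinearMap.ext h)
  set w : Fin n → ℂ := fun i => φ (Pi.single i 1) with hw
  have hφw : ∀ t, φ t = w ⬝ᵥ t := by
    intro t
    rw [LinearMap.pi_apply_eq_sum_univ φ t, dotProduct_comm]
    refine Finset.sum_congr rfl fun i _ => ?_
    rw [hw, smul_eq_mul]
    congr 2
    funext j
    simp [Pi.single_apply, eq_comm]
  -- The factor `(φ v)⁻¹` makes the row take the value `1` on the column, which is what idempotence
  -- requires.
  refine ⟨vecMulVec ((φ v)⁻¹ • v) w, isMinimalIdempotent_vecMulVec ?_, fun x hx => ?_⟩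
  · rw [← hφw, map_smul, smul_eq_mul, inv_mul_cancel₀ hv]
  · have : w ᵥ* x = 0 := by
      funext j
      have hj : x.col j ∈ R := fun ψ => by
        have := hI (vecMulVec (Pi.single j 1) ψ) x hx
        rwa [mul_vecMulVec, mulVec_single_one] at this
      have h0 : φ (x.col j) = 0 := hφ hj
      rw [hφw] at h0
      exact h0
    rw [vecMulVec_mul, this, vecMulVec_zero]

theorem IsMinimalIdempotent.transpose {f : Mat n} (hf : IsMinimalIdempotent f) :
    IsMinimalIdempotent (fᵀ : Mat n) := by
  obtain ⟨hf0, hf1, hf2⟩ := isMinimalIdempotent_iff.mp hf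
  refine isMinimalIdempotent_iff.mpr ⟨fun h => hf0 (by simpa using h), ?_, fun a => ?_⟩
  · rw [← transpose_mul, hf1]
  · obtain ⟨z, hz⟩ := hf2 aᵀ
    refine ⟨z, ?_⟩
    rw [← transpose_smul, ← hz]
    simp [transpose_mul, mul_assoc]

theorem exists_minimalIdempotent_mul_eq_zero' {I : Submodule ℂ (Mat n)} (hI : IsLeftIdeal I)
    (htop : I ≠ ⊤) : ∃ f : Mat n, IsMinimalIdempotent f ∧ ∀ x ∈ I, x * f = 0 := by
  let T : Mat n →ₗ[ℂ] Mat n := (transposeLinearEquiv (Fin n) (Fin n) ℂ ℂ).toLinearMap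
  have hT : ∀ x : Mat n, x ∈ I.comap T ↔ xᵀ ∈ I := fun _ => Iff.rfl
  obtain ⟨f, hf, hfI⟩ := exists_minimalIdempotent_mul_eq_zero (I := I.comap T)
    (fun a x hx => by
      rw [hT] at hx ⊢
      rw [transpose_mul]
      exact hI _ _ hx)
    (fun h => htop (eq_top_iff.mpr fun x _ => by
      have : xᵀ ∈ I.comap T := h ▸ Submodule.mem_top
      rwa [hT, transpose_transpose] at this))
  refine ⟨fᵀ, hf.transpose, fun x hx => ?_⟩
  have := hfI xᵀ (by rwa [hT, transpose_transpose])
  rw [← transpose_transpose x, ← transpose_mul, this, transpose_zero]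

end MatrixIdeals

/-! ### Block components of the algebra -/

section Blocks

variable {c : ℕ+ → ℝ} {hc : ∀ n, 1 < c n}

namespace AlgA

/-- The matrix `x_n` of the tuple `((x_n, d_n x_n d_n⁻¹))_n`. -/
def comp (n : ℕ+) : AlgA c hc →ₗ[ℂ] Mat n where
  toFun a := (a.1 n).1
  map_add' _ _ := rfl
  map_smul' _ _ := rfl

theorem val_apply (a : AlgA c hc) (n : ℕ+) : a.1 n = twist c n (comp n a) := by
  obtain ⟨x, hx⟩ := a.2.1 n
  rw [hx]
  change _ = twist c n (a.1 n).1
  rw [hx]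
  rfl

theorem comp_mul (n : ℕ+) (a b : AlgA c hc) : comp n (a * b) = comp n a * comp n b := rfl

/-- The second coordinate of each pair is determined by the first, so identities in `A` may be
checked on the matrices `x_n`. -/
theorem ext_comp {a b : AlgA c hc} (h : ∀ n, comp n a = comp n b) : a = b := by
  refine Subtype.ext (lp.ext (funext fun n => ?_))
  rw [val_apply, val_apply, h]

instance : IsScalarTower ℂ (AlgA c hc) (AlgA c hc) :=
  ⟨fun z a b => ext_comp fun n => smul_mul_assoc z (comp n a) (comp n b)⟩

instance : SMulCommClass ℂ (AlgA c hc) (AlgA c hc) :=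
  ⟨fun z a b => ext_comp fun n => (mul_smul_comm z (comp n a) (comp n b)).symm⟩

theorem comp_blockCopy_self (n : ℕ+) (x : Mat n) : comp n (blockCopy c hc n x) = x := by
  change ((lp.single ∞ n (twist c n x) : BigM) n).1 = x
  rw [lp.single_apply_self]
  rfl

theorem comp_blockCopy_of_ne {m n : ℕ+} (h : m ≠ n) (x : Mat n) :
    comp m (blockCopy c hc n x) = 0 := by
  change ((lp.single ∞ n (twist c n x) : BigM) m).1 = 0
  rw [lp.single_apply_ne _ _ _ h]
  rfl

theorem blockCopy_ext {n : ℕ+} {x : Mat n} {a : AlgA c hc} (h : comp n a = x)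
    (h' : ∀ m, m ≠ n → comp m a = 0) : a = blockCopy c hc n x := by
  refine ext_comp fun m => ?_
  by_cases hm : m = n
  · subst hm
    rw [comp_blockCopy_self, h]
  · rw [comp_blockCopy_of_ne hm, h' m hm]

variable (c hc) in
/-- The linear map sending a matrix to its canonical copy. -/
noncomputable def blockLin (n : ℕ+) : Mat n →ₗ[ℂ] AlgA c hc where
  toFun := blockCopy c hc n
  map_add' x y := by
    refine (blockCopy_ext ?_ fun m hm => ?_).symm
    · rw [map_add, comp_blockCopy_self, comp_blockCopy_self]
    · rw [map_add, comp_blockCopy_of_ne hm, comp_blockCopy_of_ne hm, add_zero]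
  map_smul' z x := by
    refine (blockCopy_ext ?_ fun m hm => ?_).symm
    · rw [map_smul, comp_blockCopy_self]; rfl
    · rw [map_smul, comp_blockCopy_of_ne hm, smul_zero]

theorem mul_blockCopy (a : AlgA c hc) {n : ℕ+} (x : Mat n) :
    a * blockCopy c hc n x = blockCopy c hc n (comp n a * x) := by
  refine blockCopy_ext ?_ fun m hm => ?_
  · rw [comp_mul, comp_blockCopy_self]
  · rw [comp_mul, comp_blockCopy_of_ne hm, mul_zero]

theorem blockCopy_mul (a : AlgA c hc) {n : ℕ+} (x : Mat n) :
    blockCopy c hc n x * a = blockCopy c hc n (x * comp n a) := by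
  refine blockCopy_ext ?_ fun m hm => ?_
  · rw [comp_mul, comp_blockCopy_self]
  · rw [comp_mul, comp_blockCopy_of_ne hm, zero_mul]

theorem blockCopy_mul_blockCopy {n : ℕ+} (x y : Mat n) :
    blockCopy c hc n x * blockCopy c hc n y = blockCopy c hc n (x * y) := by
  rw [blockCopy_mul, comp_blockCopy_self]

theorem blockCopy_zero (n : ℕ+) : blockCopy c hc n 0 = 0 := (blockLin c hc n).map_zero

theorem blockCopy_smul {n : ℕ+} (z : ℂ) (x : Mat n) :
    blockCopy c hc n (z • x) = z • blockCopy c hc n x := (blockLin c hc n).map_smul z x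

theorem blockCopy_eq_zero {n : ℕ+} {x : Mat n} : blockCopy c hc n x = 0 ↔ x = 0 := by
  refine ⟨fun h => ?_, fun h => h ▸ blockCopy_zero n⟩
  rw [← comp_blockCopy_self (hc := hc) n x, h, map_zero]

theorem comp_sum_blockCopy_of_mem {S : Finset ℕ+} (x : ∀ n, Mat n) {m : ℕ+} (hm : m ∈ S) :
    comp m (∑ n ∈ S, blockCopy c hc n (x n)) = x m := by
  rw [map_sum, Finset.sum_eq_single_of_mem m hm fun n _ hn => comp_blockCopy_of_ne hn.symm _,
    comp_blockCopy_self]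

theorem comp_sum_blockCopy_of_notMem {S : Finset ℕ+} (x : ∀ n, Mat n) {m : ℕ+} (hm : m ∉ S) :
    comp m (∑ n ∈ S, blockCopy c hc n (x n)) = 0 := by
  rw [map_sum]
  exact Finset.sum_eq_zero fun n hn => comp_blockCopy_of_ne (ne_of_mem_of_not_mem hn hm).symm _

end AlgA

open AlgA

theorem isMinimalIdempotent_blockCopy {n : ℕ+} {f : Mat n} (hf : IsMinimalIdempotent f) :
    IsMinimalIdempotent (blockCopy c hc n f) := by
  obtain ⟨hf0, hf1, hf2⟩ := isMinimalIdempotent_iff.mp hf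
  refine isMinimalIdempotent_iff.mpr ⟨fun h => hf0 (blockCopy_eq_zero.mp h), ?_, fun a => ?_⟩
  · rw [blockCopy_mul_blockCopy, hf1]
  · obtain ⟨z, hz⟩ := hf2 (comp n a)
    exact ⟨z, by rw [blockCopy_mul, blockCopy_mul_blockCopy, hz, blockCopy_smul]⟩

theorem exists_blockCopy_mul_right {n : ℕ+} {f : Mat n} (hf : IsMinimalIdempotent f)
    (b : AlgA c hc) (hb : blockCopy c hc n f * b ≠ 0) :
    ∃ y, blockCopy c hc n f * b * y = blockCopy c hc n f := by
  rw [blockCopy_mul] at hb ⊢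
  obtain ⟨y, hy⟩ := hf.exists_mul_right fun h => hb (blockCopy_eq_zero.mpr h)
  exact ⟨blockCopy c hc n y, by rw [blockCopy_mul_blockCopy, hy]⟩

theorem exists_blockCopy_mul_left {n : ℕ+} {f : Mat n} (hf : IsMinimalIdempotent f)
    (b : AlgA c hc) (hb : b * blockCopy c hc n f ≠ 0) :
    ∃ y, y * (b * blockCopy c hc n f) = blockCopy c hc n f := by
  rw [mul_blockCopy] at hb ⊢
  obtain ⟨y, hy⟩ := hf.exists_mul_left fun h => hb (blockCopy_eq_zero.mpr h)
  exact ⟨blockCopy c hc n y, by rw [blockCopy_mul_blockCopy, hy]⟩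

/-! ### Quasi-invertibility modulo finitely many blocks -/

/-- The multiplier `w` need not lie in `A`. Commuting with `a`, it can always be moved to the side
away from `u_k`. -/
theorem mul_mem_algA_of_comm {a w : BigM} (ha : a ∈ algA c hc) (hcomm : w * a = a * w)
    (hN : w * a ∈ algN c hc) : w * a ∈ algA c hc := by
  obtain ⟨-, hlim⟩ := ha
  have hlimw := hlim.const_mul ‖w‖
  rw [mul_zero] at hlimw
  refine ⟨hN, squeeze_zero (fun k => add_nonneg (norm_nonneg _) (norm_nonneg _))
    (fun k => ?_) hlimw⟩
  have h1 : w * a * uElt c hc k - w * a = w * (a * uElt c hc k - a) := by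
    rw [mul_sub, mul_assoc]
  have h2 : uElt c hc k * (w * a) - w * a = (uElt c hc k * a - a) * w := by
    rw [hcomm, sub_mul, mul_assoc]
  rw [h1, h2, mul_add, mul_comm ‖w‖ ‖uElt c hc k * a - a‖]
  exact add_le_add (norm_mul_le _ _) (norm_mul_le _ _)

/-- An inverse `v` of `1 - x` satisfies `v = 1 + v * x`, so `q = w * u` works, where `w` is the
bounded tuple of block inverses. -/
theorem exists_quasiInverse_off_finset (hmono : Monotone c) (hunb : ¬ BddAbove (Set.range c))
    (u : AlgA c hc) :
    ∃ (q : AlgA c hc) (S : Finset ℕ+), ∀ n ∉ S, (1 + comp n q) * (1 - comp n u) = 1 ∧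
      (1 - comp n u) * (1 + comp n q) = 1 := by
  have hlim : Tendsto c atTop atTop := tendsto_atTop_atTop_of_monotone' hmono hunb
  have hu : Tendsto (fun k => ‖u.1 * uElt c hc k - u.1‖ + ‖uElt c hc k * u.1 - u.1‖) atTop (𝓝 0) :=
    u.2.2
  set K := ‖u.1‖ with hKdef
  have hK0 : 0 ≤ K := norm_nonneg _
  obtain ⟨k, hk⟩ : ∃ k, ‖u.1 * uElt c hc k - u.1‖ ≤ 1 / 8 := by
    obtain ⟨k, hk⟩ := (hu.eventually (gt_mem_nhds (by norm_num : (0 : ℝ) < 1 / 8))).exists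
    exact ⟨k, by linarith [norm_nonneg (uElt c hc k * u.1 - u.1)]⟩
  have hlim0 : Tendsto (fun n => K / (c n - 1)) atTop (𝓝 0) :=
    (tendsto_atTop_add_const_right _ (-1) hlim).const_div_atTop K
  have hlim1 : Tendsto (fun n => K / (c n - 1) * inverseBound (K + 1) k) atTop (𝓝 0) := by
    simpa using hlim0.mul_const (inverseBound (K + 1) k)
  obtain ⟨N, hN⟩ := eventually_atTop.mp
    ((hlim0.eventually (gt_mem_nhds (by norm_num : (0 : ℝ) < 1 / 8))).and
      ((hlim1.eventually (gt_mem_nhds (by norm_num : (0 : ℝ) < 1 / 2))).and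
        (eventually_ge_atTop k)))
  set C := max (2 * inverseBound (K + 1) k) 2 with hC
  have hv : ∀ n, ∃ v : Mat n, ‖twist c n v‖ ≤ C ∧ (N ≤ n → v * (1 - comp n u) = 1 ∧
      (1 - comp n u) * v = 1) ∧ (¬ N ≤ n → v = 0) := by
    intro n
    by_cases hn : N ≤ n
    · obtain ⟨h1, h2, h3⟩ := hN n hn
      obtain ⟨v, hv1, hv2, hv3⟩ := exists_inverse_one_sub_block hc h3 (x := comp n u) (K := K)
        (by rw [← val_apply]; exact lp.norm_apply_le_norm ENNReal.top_ne_zero u.1 n)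
        (by
          rw [← val_apply]
          exact (lp.norm_apply_le_norm ENNReal.top_ne_zero (u.1 * uElt c hc k - u.1) n).trans hk)
        h1.le h2.le
      exact ⟨v, hv3, fun _ => ⟨hv1, hv2⟩, fun h => absurd hn h⟩
    -- In the finitely many small blocks `1 - u` may be singular; the value `0` keeps `w` bounded
    -- and commuting with `u`.
    · exact ⟨0, by rw [twist_zero, norm_zero]; exact zero_le_two.trans (le_max_right _ _),
        fun h => absurd h hn, fun _ => rfl⟩
  choose v hvC hvN hv0 using hv
  let w : BigM := ⟨fun n => twist c n (v n), memℓp_infty ⟨C, by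
    rintro _ ⟨n, rfl⟩
    exact hvC n⟩⟩
  have hwu : ∀ n, (w * u.1) n = twist c n (v n * comp n u) := fun n => by
    rw [twist_mul hc, ← val_apply]; rfl
  have hcomm : w * u.1 = u.1 * w := by
    refine lp.ext (funext fun n => ?_)
    have h2 : (u.1 * w) n = twist c n (comp n u * v n) := by
      rw [twist_mul hc, ← val_apply]; rfl
    rw [hwu, h2]
    by_cases hn : N ≤ n
    -- Both `v * x` and `x * v` equal `v - 1`.
    · obtain ⟨h3, h4⟩ := hvN n hn
      rw [mul_sub, mul_one, sub_eq_iff_eq_add, ← sub_eq_iff_eq_add'] at h3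
      rw [sub_mul, one_mul, sub_eq_iff_eq_add, ← sub_eq_iff_eq_add'] at h4
      rw [← h3, ← h4]
    · rw [hv0 n hn, zero_mul, mul_zero]
  have hmem : w * u.1 ∈ algA c hc := mul_mem_algA_of_comm u.2 hcomm fun n => ⟨_, hwu n⟩
  refine ⟨⟨w * u.1, hmem⟩, Finset.Iio N, fun n hn => ?_⟩
  have hn' : N ≤ n := not_lt.mp fun h => hn (Finset.mem_Iio.mpr h)
  obtain ⟨h3, h4⟩ := hvN n hn'
  have hq : comp n (⟨w * u.1, hmem⟩ : AlgA c hc) = v n * comp n u := congrArg Prod.fst (hwu n)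
  have : 1 + comp n (⟨w * u.1, hmem⟩ : AlgA c hc) = v n := by
    rw [hq, ← h3]
    rw [mul_sub, mul_one, sub_add_cancel]
  rw [this]
  exact ⟨h3, h4⟩

variable {J : Submodule ℂ (AlgA c hc)}

/-- After removal of its components in the finite exceptional set, which lie in `J`, any element
belongs to `(1 - u)A`, because `1 - u` has right inverse `1 + q` on the other blocks. -/
theorem IsModularRightIdeal.eq_top_of_blockCopy_mem (hmono : Monotone c)
    (hunb : ¬ BddAbove (Set.range c)) (hJ : IsModularRightIdeal J)
    (h : ∀ n x, blockCopy c hc n x ∈ J) : J = ⊤ := by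
  obtain ⟨-, u, hu⟩ := hJ
  obtain ⟨q, S, hq⟩ := exists_quasiInverse_off_finset hmono hunb u
  refine eq_top_iff.mpr fun b _ => ?_
  set s := ∑ n ∈ S, blockCopy c hc n (comp n b) with hs
  have hsJ : s ∈ J := J.sum_mem fun n _ => h n _
  have hb : b - s = (b - s + q * (b - s)) - u * (b - s + q * (b - s)) := by
    refine ext_comp fun n => ?_
    simp only [map_sub, map_add, comp_mul]
    by_cases hn : n ∈ S
    · rw [hs, comp_sum_blockCopy_of_mem (comp · b) hn]
      simp
    · calc comp n b - comp n s = 1 * (comp n b - comp n s) := (one_mul _).symm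
        _ = _ := by rw [← (hq n hn).2]; noncomm_ring
  have := J.add_mem (hu (b - s + q * (b - s))) hsJ
  rwa [← hb, sub_add_cancel] at this

theorem IsModularLeftIdeal.eq_top_of_blockCopy_mem (hmono : Monotone c)
    (hunb : ¬ BddAbove (Set.range c)) (hJ : IsModularLeftIdeal J)
    (h : ∀ n x, blockCopy c hc n x ∈ J) : J = ⊤ := by
  obtain ⟨-, u, hu⟩ := hJ
  obtain ⟨q, S, hq⟩ := exists_quasiInverse_off_finset hmono hunb u
  refine eq_top_iff.mpr fun b _ => ?_
  set s := ∑ n ∈ S, blockCopy c hc n (comp n b) with hs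
  have hsJ : s ∈ J := J.sum_mem fun n _ => h n _
  have hb : b - s = (b - s + (b - s) * q) - (b - s + (b - s) * q) * u := by
    refine ext_comp fun n => ?_
    simp only [map_sub, map_add, comp_mul]
    by_cases hn : n ∈ S
    · rw [hs, comp_sum_blockCopy_of_mem (comp · b) hn]
      simp
    · calc comp n b - comp n s = (comp n b - comp n s) * 1 := (mul_one _).symm
        _ = _ := by rw [← (hq n hn).1]; noncomm_ring
  have := J.add_mem (hu (b - s + (b - s) * q)) hsJ
  rwa [← hb, sub_add_cancel] at this

/-! ### Maximal modular ideals -/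

theorem isMaximalModularRightIdeal_iff (hmono : Monotone c) (hunb : ¬ BddAbove (Set.range c)) :
    IsMaximalModularRightIdeal J ↔ ∃ e : AlgA c hc, IsMinimalIdempotent e ∧
      (∃ (n : ℕ+) (f : Mat n), IsMinimalIdempotent f ∧ e = blockCopy c hc n f) ∧
      (J : Set (AlgA c hc)) = Set.range fun a => a - e * a := by
  constructor
  · intro hJ
    obtain ⟨n, x, hx⟩ : ∃ n x, blockCopy c hc n x ∉ J := by
      by_contra! h
      exact hJ.prop.2 (hJ.prop.1.eq_top_of_blockCopy_mem hmono hunb h)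
    have hJr := hJ.prop.1.1
    obtain ⟨f, hf, hfI⟩ := exists_minimalIdempotent_mul_eq_zero (I := J.comap (blockLin c hc n))
      (fun a y hy => by
        have := hJr (blockCopy c hc n a) _ hy
        rwa [show blockLin c hc n y = blockCopy c hc n y from rfl,
          blockCopy_mul_blockCopy] at this)
      (fun h => hx (show x ∈ J.comap (blockLin c hc n) from h ▸ Submodule.mem_top))
    have he := isMinimalIdempotent_blockCopy (hc := hc) hf
    have hle : J ≤ rightAnnihilator (blockCopy c hc n f) := fun a ha => by
      -- Right multiplication by the unit of the block cuts `a` down to its `n`-th component without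
      -- leaving `J`.
      have h1 : comp n a ∈ J.comap (blockLin c hc n) := by
        have := hJr (blockCopy c hc n 1) a ha
        rwa [mul_blockCopy, mul_one] at this
      rw [mem_rightAnnihilator, blockCopy_mul, hfI _ h1, blockCopy_zero]
    -- The annihilator is itself proper and modular, so the maximal ideal `J` cannot be strictly
    -- smaller.
    have heq := le_antisymm hle
      (hJ.le_of_ge (isModularRightIdeal_rightAnnihilator he.1 he.2.1) hle)
    refine ⟨_, he, ⟨n, f, hf, rfl⟩, ?_⟩
    rw [heq, range_sub_mul_eq he.2.1]
    rfl
  · rintro ⟨_, he, ⟨n, f, hf, rfl⟩, hJ⟩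
    have : J = rightAnnihilator (blockCopy c hc n f) := by
      refine SetLike.coe_injective ?_
      rw [hJ, range_sub_mul_eq he.2.1]
      rfl
    rw [this]
    exact isMaximalModularRightIdeal_rightAnnihilator he.1 he.2.1 (exists_blockCopy_mul_right hf)

theorem isMaximalModularLeftIdeal_iff (hmono : Monotone c) (hunb : ¬ BddAbove (Set.range c)) :
    IsMaximalModularLeftIdeal J ↔ ∃ e : AlgA c hc, IsMinimalIdempotent e ∧
      (∃ (n : ℕ+) (f : Mat n), IsMinimalIdempotent f ∧ e = blockCopy c hc n f) ∧
      (J : Set (AlgA c hc)) = Set.range fun a => a - a * e := by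
  constructor
  · intro hJ
    obtain ⟨n, x, hx⟩ : ∃ n x, blockCopy c hc n x ∉ J := by
      by_contra! h
      exact hJ.prop.2 (hJ.prop.1.eq_top_of_blockCopy_mem hmono hunb h)
    have hJl := hJ.prop.1.1
    obtain ⟨f, hf, hfI⟩ := exists_minimalIdempotent_mul_eq_zero' (I := J.comap (blockLin c hc n))
      (fun a y hy => by
        have := hJl (blockCopy c hc n a) _ hy
        rwa [show blockLin c hc n y = blockCopy c hc n y from rfl,
          blockCopy_mul_blockCopy] at this)
      (fun h => hx (show x ∈ J.comap (blockLin c hc n) from h ▸ Submodule.mem_top))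
    have he := isMinimalIdempotent_blockCopy (hc := hc) hf
    have hle : J ≤ leftAnnihilator (blockCopy c hc n f) := fun a ha => by
      have h1 : comp n a ∈ J.comap (blockLin c hc n) := by
        have := hJl (blockCopy c hc n 1) a ha
        rwa [blockCopy_mul, one_mul] at this
      rw [mem_leftAnnihilator, mul_blockCopy, hfI _ h1, blockCopy_zero]
    have heq := le_antisymm hle
      (hJ.le_of_ge (isModularLeftIdeal_leftAnnihilator he.1 he.2.1) hle)
    refine ⟨_, he, ⟨n, f, hf, rfl⟩, ?_⟩
    rw [heq, range_sub_mul_eq' he.2.1]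
    rfl
  · rintro ⟨_, he, ⟨n, f, hf, rfl⟩, hJ⟩
    have : J = leftAnnihilator (blockCopy c hc n f) := by
      refine SetLike.coe_injective ?_
      rw [hJ, range_sub_mul_eq' he.2.1]
      rfl
    rw [this]
    exact isMaximalModularLeftIdeal_leftAnnihilator he.1 he.2.1 (exists_blockCopy_mul_left hf)

/-! ### The socle -/

variable (c hc) in
/-- The sum of all blocks, that is, the finitely supported elements of the algebra. -/
noncomputable def blockSum : Submodule ℂ (AlgA c hc) := ⨆ n, LinearMap.range (blockLin c hc n)

theorem blockCopy_mem_blockSum (n : ℕ+) (x : Mat n) : blockCopy c hc n x ∈ blockSum c hc :=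
  Submodule.mem_iSup_of_mem n ⟨x, rfl⟩

theorem finite_support_of_mem_blockSum {a : AlgA c hc} (ha : a ∈ blockSum c hc) :
    {n | comp n a ≠ 0}.Finite := by
  induction ha using Submodule.iSup_induction' with
  | mem n a ha =>
    obtain ⟨x, rfl⟩ := ha
    refine (Set.finite_singleton n).subset fun m hm => ?_
    by_contra hne
    exact hm (comp_blockCopy_of_ne hne x)
  | zero => simp
  | add a b _ _ h1 h2 =>
    refine (h1.union h2).subset fun m hm => ?_
    by_contra hne
    simp only [Set.mem_union, Set.mem_ofPred_eq, not_or, not_not] at hne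
    exact hm (by rw [map_add, hne.1, hne.2, add_zero])

theorem incl_image_blockSum :
    AlgA.incl c hc '' (blockSum c hc : Set (AlgA c hc)) = finSupp c hc := by
  ext a
  constructor
  · rintro ⟨a, ha, rfl⟩
    refine ⟨a.2.1, (finite_support_of_mem_blockSum ha).subset fun n hn h0 => hn ?_⟩
    change a.1 n = 0
    rw [val_apply, h0, twist_zero]
  · rintro ⟨haN, hfin⟩
    choose x hx using haN
    refine ⟨∑ n ∈ hfin.toFinset, blockCopy c hc n (x n),
      Submodule.sum_mem _ fun n _ => blockCopy_mem_blockSum n _, ?_⟩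
    refine lp.ext (funext fun n => ?_)
    rw [AlgA.incl, val_apply]
    by_cases hn : n ∈ hfin.toFinset
    · rw [comp_sum_blockCopy_of_mem x hn, hx]
    · rw [comp_sum_blockCopy_of_notMem x hn, twist_zero]
      simpa [eq_comm] using hn

theorem sum_mul_single {n : ℕ+} (x : Mat n) : ∑ j, x * Matrix.single j j 1 = x := by
  rw [← Finset.mul_sum, Matrix.sum_single_one, mul_one]

theorem sum_single_mul {n : ℕ+} (x : Mat n) : ∑ j, Matrix.single j j 1 * x = x := by
  rw [← Finset.sum_mul, Matrix.sum_single_one, one_mul]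

/-- Blocks are two-sided ideals with units, so a minimal left ideal with a nonzero `n`-th component
meets the `n`-th block and hence lies in it. Conversely, a block is the sum of its columns, each the
minimal left ideal of a diagonal matrix unit. -/
theorem leftSocle_eq_blockSum : leftSocle (AlgA c hc) = blockSum c hc := by
  refine le_antisymm (sSup_le fun J hJ => ?_) (iSup_le fun n => ?_)
  · have hJ : IsMinimalLeftIdeal J := hJ
    obtain ⟨b, hb, hb0⟩ := J.ne_bot_iff.mp hJ.prop.2
    obtain ⟨n, hn⟩ : ∃ n, comp n b ≠ 0 := by
      by_contra! h
      exact hb0 (ext_comp fun n => by rw [h, map_zero])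
    have hK : IsLeftIdeal (J ⊓ LinearMap.range (blockLin c hc n)) := by
      rintro a _ ⟨hx, y, rfl⟩
      exact ⟨hJ.prop.1 a _ hx, comp n a * y, (mul_blockCopy a y).symm⟩
    have hmem : blockCopy c hc n (comp n b) ∈ J ⊓ LinearMap.range (blockLin c hc n) := by
      refine ⟨?_, comp n b, rfl⟩
      have := hJ.prop.1 (blockCopy c hc n 1) b hb
      rwa [blockCopy_mul, one_mul] at this
    have hle := hJ.le_of_le ⟨hK, (Submodule.ne_bot_iff _).mpr
      ⟨_, hmem, fun h => hn (blockCopy_eq_zero.mp h)⟩⟩ inf_le_left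
    exact (hle.trans inf_le_right).trans (le_iSup (fun n => LinearMap.range (blockLin c hc n)) n)
  · rintro _ ⟨x, rfl⟩
    rw [← sum_mul_single x, map_sum]
    refine Submodule.sum_mem _ fun j _ => ?_
    have hf := isMinimalIdempotent_single j
    have he := isMinimalIdempotent_blockCopy (hc := hc) hf
    refine le_sSup (show _ ∈ {J | IsMinimalLeftIdeal J} from
      isMinimalLeftIdeal_range_mulRight he.1 he.2.1 (exists_blockCopy_mul_left hf)) ?_
    exact ⟨blockCopy c hc n x, blockCopy_mul_blockCopy x _⟩

/-- The mirror argument, with rows in place of columns. -/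
theorem rightSocle_eq_blockSum : rightSocle (AlgA c hc) = blockSum c hc := by
  refine le_antisymm (sSup_le fun J hJ => ?_) (iSup_le fun n => ?_)
  · have hJ : IsMinimalRightIdeal J := hJ
    obtain ⟨b, hb, hb0⟩ := J.ne_bot_iff.mp hJ.prop.2
    obtain ⟨n, hn⟩ : ∃ n, comp n b ≠ 0 := by
      by_contra! h
      exact hb0 (ext_comp fun n => by rw [h, map_zero])
    have hK : IsRightIdeal (J ⊓ LinearMap.range (blockLin c hc n)) := by
      rintro a _ ⟨hx, y, rfl⟩
      exact ⟨hJ.prop.1 a _ hx, y * comp n a, (blockCopy_mul a y).symm⟩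
    have hmem : blockCopy c hc n (comp n b) ∈ J ⊓ LinearMap.range (blockLin c hc n) := by
      refine ⟨?_, comp n b, rfl⟩
      have := hJ.prop.1 (blockCopy c hc n 1) b hb
      rwa [mul_blockCopy, mul_one] at this
    have hle := hJ.le_of_le ⟨hK, (Submodule.ne_bot_iff _).mpr
      ⟨_, hmem, fun h => hn (blockCopy_eq_zero.mp h)⟩⟩ inf_le_left
    exact (hle.trans inf_le_right).trans (le_iSup (fun n => LinearMap.range (blockLin c hc n)) n)
  · rintro _ ⟨x, rfl⟩
    rw [← sum_single_mul x, map_sum]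
    refine Submodule.sum_mem _ fun j _ => ?_
    have hf := isMinimalIdempotent_single j
    have he := isMinimalIdempotent_blockCopy (hc := hc) hf
    refine le_sSup (show _ ∈ {J | IsMinimalRightIdeal J} from
      isMinimalRightIdeal_range_mulLeft he.1 he.2.1 (exists_blockCopy_mul_right hf)) ?_
    exact ⟨blockCopy c hc n x, blockCopy_mul_blockCopy _ x⟩

end Blocks

theorem mainTheorem11 (c : ℕ+ → ℝ) (hc : ∀ n, 1 < c n) (hmono : Monotone c)
    (hunb : ¬ BddAbove (Set.range c)) :
    (∀ J : Submodule ℂ (AlgA c hc), IsMaximalModularRightIdeal J ↔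
      ∃ e : AlgA c hc, IsMinimalIdempotent e ∧
        (∃ (n : ℕ+) (f : Mat n), IsMinimalIdempotent f ∧ e = blockCopy c hc n f) ∧
        (J : Set (AlgA c hc)) = Set.range fun a => a - e * a) ∧
    (∀ J : Submodule ℂ (AlgA c hc), IsMaximalModularLeftIdeal J ↔
      ∃ e : AlgA c hc, IsMinimalIdempotent e ∧
        (∃ (n : ℕ+) (f : Mat n), IsMinimalIdempotent f ∧ e = blockCopy c hc n f) ∧
        (J : Set (AlgA c hc)) = Set.range fun a => a - a * e) ∧
    AlgA.incl c hc '' (leftSocle (AlgA c hc) : Set (AlgA c hc)) = finSupp c hc ∧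
    AlgA.incl c hc '' (rightSocle (AlgA c hc) : Set (AlgA c hc)) = finSupp c hc := by
  refine ⟨fun J => isMaximalModularRightIdeal_iff hmono hunb,
    fun J => isMaximalModularLeftIdeal_iff hmono hunb, ?_, ?_⟩
  · rw [leftSocle_eq_blockSum, incl_image_blockSum]
  · rw [rightSocle_eq_blockSum, incl_image_blockSum]
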